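/- Let $\phi:[0,+\infty)\to[0,+\infty)$ be a convex function with $\phi(t)=0$ if and only if $t=0$. We say that the $\phi$-rigidity property holds in $\mathbb{R}^n$ if every vector field $\eta=(\eta_1,\dots,\eta_n)\in L^\infty(\mathbb{R}^n;\mathbb{R}^n)$ such that (i) $\eta=0$ almost everywhere on $\{x\in\mathbb{R}^n: x_n<0\}$, (ii) $\operatorname{div}\eta=0$ on $\mathbb{R}^n$ in the sense of distributions, i.e. $\int_{\mathbb{R}^n}\eta\cdot\nabla\psi\,dx=0$ for all $\psi\in C_c^\infty(\mathbb{R}^n)$, and (iii) $\eta_n\ge\phi(|\eta|)$ almost everywhere on $\mathbb{R}^n$ (with $|\cdot|$ the Euclidean norm), satisfies $\eta=0$ almost everywhere on $\mathbb{R}^n$. Theorem (linear rigidity). Let $n\ge 2$ and let $c>0$ be any constant. Then $\phi(t)=ct$ is an admissible function in the above sense, and the $\phi$-rigidity property holds in $\mathbb{R}^n$ for $\phi(t)=ct$. -/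

import Mathlib

open MeasureTheory
open scoped ContDiff ENNReal

/-- A function `φ : [0,∞) → [0,∞)` that is convex and vanishes only at `0`
(only the values of `φ` on `[0,∞)` matter). -/
structure IsRigidityFunction (φ : ℝ → ℝ) : Prop where
  convexOn : ConvexOn ℝ (Set.Ici 0) φ
  nonneg : ∀ t, 0 ≤ t → 0 ≤ φ t
  eq_zero_iff : ∀ t, 0 ≤ t → (φ t = 0 ↔ t = 0)

/-- The index of the last coordinate `x_n` of `ℝⁿ`. -/
def lastIndex (n : ℕ) (hn : 2 ≤ n) : Fin n := ⟨n - 1, by omega⟩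

/-- `div η = 0` on `ℝⁿ` in the sense of distributions: `∫ η · ∇ψ = 0` for every smooth, compactly
supported `ψ`. The integrand `η(x) · ∇ψ(x)` is the differential of `ψ` at `x` applied to `η x`. -/
def IsWeaklyDivergenceFree {n : ℕ}
    (η : EuclideanSpace ℝ (Fin n) → EuclideanSpace ℝ (Fin n)) : Prop :=
  ∀ ψ : EuclideanSpace ℝ (Fin n) → ℝ, ContDiff ℝ ∞ ψ → HasCompactSupport ψ →
    ∫ x, fderiv ℝ ψ x (η x) = 0

/-- The `φ`-rigidity property in `ℝⁿ`: every `η ∈ L^∞(ℝⁿ; ℝⁿ)` that vanishes on `{x_n < 0}`, is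
divergence-free in the sense of distributions, and satisfies `η_n ≥ φ(|η|)` almost everywhere,
is zero almost everywhere. -/
def PhiRigidity (n : ℕ) (hn : 2 ≤ n) (φ : ℝ → ℝ) : Prop :=
  ∀ η : EuclideanSpace ℝ (Fin n) → EuclideanSpace ℝ (Fin n),
    MemLp η ∞ volume →
    (∀ᵐ x ∂volume, x (lastIndex n hn) < 0 → η x = 0) →
    IsWeaklyDivergenceFree η →
    (∀ᵐ x ∂volume, φ ‖η x‖ ≤ η x (lastIndex n hn)) →
    ∀ᵐ x ∂volume, η x = 0

/-! The bound `c|η| ≤ η_n` confines `η` to a convex cone about the last axis. For `0 < K < c`, `f(x)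
= x_n + K√(1+|x|²)` increases along that cone: `∇f·η ≥ (c-K)|η|`. Test `div η = 0` with a cutoff
times `g(T - f)`, `g` increasing on `(0,∞)` and zero before: on `x_n ≥ 0` the integrand is `-g'(T -
f) ∇f·η ≤ 0`, and elsewhere `η = 0`. Its integral is zero, so `η = 0` a.e. on `{f < T}`; let `T →
∞`. -/

theorem isRigidityFunction_const_mul {c : ℝ} (hc : 0 < c) :
    IsRigidityFunction (fun t : ℝ => c * t) where
  convexOn := by
    refine ⟨convex_Ici 0, fun x _ y _ a b _ _ _ => le_of_eq ?_⟩
    simp only [smul_eq_mul]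
    ring
  nonneg t ht := by positivity
  eq_zero_iff t _ := by simp [hc.ne']

theorem expNegInvGlue.exists_hasDerivAt_pos {x : ℝ} (hx : 0 < x) :
    ∃ d, 0 < d ∧ HasDerivAt expNegInvGlue d x := by
  refine ⟨Real.exp (-x⁻¹) * (-(-(x ^ 2)⁻¹)), ?_, ?_⟩
  · rw [neg_neg]
    positivity
  · refine ((hasDerivAt_inv hx.ne').neg.exp).congr_of_eventuallyEq ?_
    filter_upwards [lt_mem_nhds hx] with y hy
    simp [expNegInvGlue, not_le.2 hy]

/-- At `x ≤ 0` the function attains its minimum, so its derivative vanishes there. -/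
theorem expNegInvGlue.exists_hasDerivAt_nonneg (x : ℝ) :
    ∃ d, 0 ≤ d ∧ (0 < x → 0 < d) ∧ HasDerivAt expNegInvGlue d x := by
  rcases lt_or_ge 0 x with hx | hx
  · obtain ⟨d, hd, h⟩ := expNegInvGlue.exists_hasDerivAt_pos hx
    exact ⟨d, hd.le, fun _ => hd, h⟩
  · have hd : DifferentiableAt ℝ expNegInvGlue x :=
      (expNegInvGlue.contDiff (n := 1)).differentiable one_ne_zero x
    refine ⟨0, le_rfl, fun h => absurd h hx.not_gt, ?_⟩
    have hmin : IsLocalMin expNegInvGlue x := by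
      refine Filter.Eventually.of_forall fun y => ?_
      rw [expNegInvGlue.zero_of_nonpos hx]
      exact expNegInvGlue.nonneg y
    simpa [hmin.deriv_eq_zero] using hd.hasDerivAt

/-- Pairing the differential of a smooth compactly supported function with an essentially bounded
vector field gives an integrable function. -/
theorem integrable_fderiv_apply_of_memLp_top {E : Type*} [NormedAddCommGroup E] [NormedSpace ℝ E]
    [MeasurableSpace E] [BorelSpace E] [SecondCountableTopology E] [FiniteDimensional ℝ E]
    {μ : Measure E} [IsFiniteMeasureOnCompacts μ] {ψ : E → ℝ} (hψ : ContDiff ℝ ∞ ψ)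
    (hs : HasCompactSupport ψ) {η : E → E} (hη : MemLp η ∞ μ) :
    Integrable (fun x => fderiv ℝ ψ x (η x)) μ := by
  have hcont : Continuous (fderiv ℝ ψ) := hψ.continuous_fderiv (by simp)
  have hint : Integrable (fderiv ℝ ψ) μ :=
    hcont.integrable_of_hasCompactSupport (hs.fderiv (𝕜 := ℝ))
  refine (hint.norm.mul_const (eLpNormEssSup η μ).toReal).mono'
    (isBoundedBilinearMap_apply.continuous.comp_aestronglyMeasurable
      (hint.aestronglyMeasurable.prodMk hη.aestronglyMeasurable)) ?_
  have hfin : eLpNormEssSup η μ ≠ ⊤ := by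
    simpa [eLpNorm_exponent_top] using hη.eLpNorm_ne_top
  filter_upwards [enorm_ae_le_eLpNormEssSup η μ] with x hx
  refine (ContinuousLinearMap.le_opNorm _ _).trans ?_
  gcongr
  simpa using ENNReal.toReal_mono hfin hx

section ConeFunction

variable {n : ℕ} (i : Fin n) (K : ℝ)

/-- The function `x ↦ xᵢ + K √(1 + |x|²)`, whose sublevel sets are bounded on half-spaces
`{xᵢ ≥ a}`. -/
noncomputable def coneFunction (x : EuclideanSpace ℝ (Fin n)) : ℝ :=
  x i + K * √(1 + ‖x‖ ^ 2)

theorem contDiff_coneFunction : ContDiff ℝ ∞ (coneFunction i K) := by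
  unfold coneFunction
  refine ContDiff.add (by fun_prop) (contDiff_const.mul (ContDiff.sqrt ?_ fun x => by positivity))
  exact contDiff_const.add (contDiff_norm_sq ℝ)

/-- Cauchy–Schwarz: the gradient `x/√(1+|x|²)` of the square root has norm at most 1. -/
theorem le_fderiv_coneFunction_apply (hK : 0 ≤ K) (x v : EuclideanSpace ℝ (Fin n)) :
    v i - K * ‖v‖ ≤ fderiv ℝ (coneFunction i K) x v := by
  have hpos : 0 < 1 + ‖x‖ ^ 2 := by positivity
  have h1 : HasFDerivAt (fun y : EuclideanSpace ℝ (Fin n) => y i)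
      (EuclideanSpace.proj i : EuclideanSpace ℝ (Fin n) →L[ℝ] ℝ) x :=
    (EuclideanSpace.proj i : EuclideanSpace ℝ (Fin n) →L[ℝ] ℝ).hasFDerivAt
  have h2 := (((hasStrictFDerivAt_norm_sq x).hasFDerivAt.const_add 1).sqrt hpos.ne').const_mul K
  have h : HasFDerivAt (coneFunction i K) _ x := h1.add h2
  rw [h.fderiv]
  have hs : 0 < √(1 + ‖x‖ ^ 2) := Real.sqrt_pos.2 hpos
  have hxs : ‖x‖ ≤ √(1 + ‖x‖ ^ 2) := Real.le_sqrt_of_sq_le (by linarith)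
  have hin : -(‖x‖ * ‖v‖) ≤ inner ℝ x v := (abs_le.1 (abs_real_inner_le_norm x v)).1
  have key : -‖v‖ ≤ (√(1 + ‖x‖ ^ 2))⁻¹ * inner ℝ x v := by
    rw [inv_mul_eq_div, le_div_iff₀ hs]
    nlinarith [norm_nonneg v]
  have := mul_le_mul_of_nonneg_left key hK
  have e : K * (1 / (2 * √(1 + ‖x‖ ^ 2)) * (2 * inner ℝ x v)) =
      K * ((√(1 + ‖x‖ ^ 2))⁻¹ * inner ℝ x v) := by
    field_simp
  simp
  simp at e
  linarith

variable (T : ℝ)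

/-- A smooth compactly supported test function which, on the half-space `{xᵢ > -1}`, is a
nonincreasing function of `coneFunction i K`, strictly so on `{coneFunction i K < T}`. -/
noncomputable def coneTest (x : EuclideanSpace ℝ (Fin n)) : ℝ :=
  Real.smoothTransition (x i + 2) * expNegInvGlue (T - coneFunction i K x)

theorem contDiff_coneTest : ContDiff ℝ ∞ (coneTest i K T) := by
  unfold coneTest
  refine ContDiff.mul (Real.smoothTransition.contDiff.comp (by fun_prop)) ?_
  exact expNegInvGlue.contDiff.comp (contDiff_const.sub (contDiff_coneFunction i K))

/-- Where neither factor vanishes, `xᵢ > -2` and `xᵢ + K|x| < T`, hence `K|x| < T + 2`. -/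
theorem hasCompactSupport_coneTest (hK : 0 < K) : HasCompactSupport (coneTest i K T) := by
  refine HasCompactSupport.intro (isCompact_closedBall 0 ((T + 2) / K)) fun x hx => ?_
  rw [mem_closedBall_zero_iff, not_le, div_lt_iff₀ hK] at hx
  rcases le_or_gt (x i + 2) 0 with h | h
  · simp [coneTest, Real.smoothTransition.zero_of_nonpos h]
  · have hxs : ‖x‖ ≤ √(1 + ‖x‖ ^ 2) := Real.le_sqrt_of_sq_le (by linarith)
    have : T - coneFunction i K x ≤ 0 := by
      unfold coneFunction
      nlinarith
    simp [coneTest, expNegInvGlue.zero_of_nonpos this]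

theorem exists_fderiv_coneTest_eq {x : EuclideanSpace ℝ (Fin n)} (hx : -1 < x i) :
    ∃ d : ℝ, 0 ≤ d ∧ (coneFunction i K x < T → 0 < d) ∧
      ∀ v, fderiv ℝ (coneTest i K T) x v = -(d * fderiv ℝ (coneFunction i K) x v) := by
  obtain ⟨d, hd0, hd, hderiv⟩ := expNegInvGlue.exists_hasDerivAt_nonneg (T - coneFunction i K x)
  refine ⟨d, hd0, fun h => hd (sub_pos.2 h), fun v => ?_⟩
  have hcone : HasFDerivAt (coneFunction i K) (fderiv ℝ (coneFunction i K) x) x :=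
    ((contDiff_coneFunction i K).differentiable (by simp) x).hasFDerivAt
  -- The cutoff is identically 1 near `x`, so it contributes no derivative.
  have hev : coneTest i K T =ᶠ[nhds x] fun y => expNegInvGlue (T - coneFunction i K y) := by
    have hi : Continuous fun y : EuclideanSpace ℝ (Fin n) => y i := by fun_prop
    filter_upwards [hi.continuousAt.eventually (lt_mem_nhds hx)] with y hy
    rw [coneTest, Real.smoothTransition.one_of_one_le (by linarith), one_mul]
  have h := (hderiv.comp_hasFDerivAt x (hcone.const_sub T)).congr_of_eventuallyEq hev
  rw [h.fderiv]
  simp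

end ConeFunction

theorem phiRigidity_const_mul (n : ℕ) (hn : 2 ≤ n) {c : ℝ} (hc : 0 < c) :
    PhiRigidity n hn (fun t : ℝ => c * t) := by
  intro η hη hsupp hdiv hcone
  set i := lastIndex n hn
  -- Any slope in `(0, c)` would do: positive for compact support, below `c` for coercivity.
  have hK : 0 < c / 2 := half_pos hc
  have hlower : ∀ x, c * ‖η x‖ ≤ η x i →
      c / 2 * ‖η x‖ ≤ fderiv ℝ (coneFunction i (c / 2)) x (η x) := fun x hx => by
    have := le_fderiv_coneFunction_apply i (c / 2) hK.le x (η x)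
    linarith
  have hzero : ∀ T : ℕ, ∀ᵐ x ∂volume, coneFunction i (c / 2) x < T → η x = 0 := by
    intro T
    have hψ := contDiff_coneTest i (c / 2) T
    have hs := hasCompactSupport_coneTest i (c / 2) T hK
    have hnonpos : 0 ≤ᵐ[volume] fun x => -fderiv ℝ (coneTest i (c / 2) T) x (η x) := by
      filter_upwards [hsupp, hcone] with x hx hx'
      rcases lt_or_ge (x i) 0 with h | h
      · simp [hx h]
      · obtain ⟨d, hd0, -, hd⟩ :=
          exists_fderiv_coneTest_eq i (c / 2) T (show -1 < x i by linarith)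
        rw [Pi.zero_apply, hd, neg_neg]
        exact mul_nonneg hd0 (le_trans (by positivity) (hlower x hx'))
    have hint := (integrable_fderiv_apply_of_memLp_top hψ hs hη).neg
    have hae := (integral_eq_zero_iff_of_nonneg_ae hnonpos hint).1 (by
      rw [integral_neg, hdiv _ hψ hs, neg_zero])
    filter_upwards [hsupp, hcone, hae] with x hx hx' hx0 hT
    rcases lt_or_ge (x i) 0 with h | h
    · exact hx h
    · obtain ⟨d, -, hdpos, hd⟩ :=
        exists_fderiv_coneTest_eq i (c / 2) T (show -1 < x i by linarith)
      rw [Pi.zero_apply, hd, neg_neg] at hx0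
      have h0 := (mul_eq_zero.1 hx0).resolve_left (hdpos hT).ne'
      have hle := hlower x hx'
      rw [h0] at hle
      exact norm_le_zero_iff.1 (nonpos_of_mul_nonpos_right hle hK)
  filter_upwards [ae_all_iff.2 hzero] with x hx
  obtain ⟨T, hT⟩ := exists_nat_gt (coneFunction i (c / 2) x)
  exact hx T hT

theorem theorem1p1 (n : ℕ) (hn : 2 ≤ n) (c : ℝ) (hc : 0 < c) :
    IsRigidityFunction (fun t : ℝ => c * t) ∧ PhiRigidity n hn (fun t : ℝ => c * t) :=
  ⟨isRigidityFunction_const_mul hc, phiRigidity_const_mul n hn hc⟩
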